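/- Let $N\ge 1$, let $\Sigma$ be a positive semidefinite $d\times d$ real matrix, and let $S\subset\mathbb R^d$ be symmetric ($v\in S\Rightarrow -v\in S$) with $\mathrm{span}(S)=\mathbb R^d$. For $x\in\mathbb R^d$ put $\|x\|_S=\sup_{v\in S}\langle v,x\rangle$, and let $\ell^*(\Sigma^{1/2}S)=\mathbb E\sup_{x\in\Sigma^{1/2}S}\langle G,x\rangle$ with $G\sim\mathcal N(0,I_d)$ be the Gaussian mean width of $\Sigma^{1/2}S$ (suprema and expectation take values in $[0,\infty]$). For $\mu\in\mathbb R^d$ let $\mathbb P_\mu^N$ be the joint law of $N$ i.i.d. random vectors $X_1,\dots,X_N\sim\mathcal N(\mu,\Sigma)$. Let $\delta\in(0,1/4]$ and $r^*\ge 0$. If $\hat\mu:\mathbb R^{Nd}\to\mathbb R^d$ is a (measurable) estimator such that $$\mathbb P_{\mu^*}^N\big[\|\hat\mu(X_1,\dots,X_N)-\mu^*\|_S\le r^*\big]\ge 1-\delta\qquad\text{for all }\mu^*\in\mathbb R^d,$$ then $$r^*\ \ge\ \max\left(\frac1{24}\sqrt{\frac{\log 2}{\log(5/4)}}\;\frac{\ell^*(\Sigma^{1/2}S)}{\sqrt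 N},\ \ \frac{1}{12}\,\sup_{v\in S}\|\Sigma^{1/2}v\|_2\,\sqrt{\frac{\log(1/\delta)}{N}}\right).$$ -/

import Mathlib

open MeasureTheory ProbabilityTheory
open scoped ENNReal NNReal MatrixOrder

noncomputable section

/-- The pseudo-norm `‖x‖_S = sup_{v ∈ S} ⟪v, x⟫` of a symmetric set `S ⊆ ℝ^d`, as an element of
`[0, ∞]` (`S` may be unbounded). As `S` is symmetric, taking the positive part of `⟪v, x⟫` (this is
what `ENNReal.ofReal` does) leaves the supremum unchanged; the supremum over `∅`, which is possible
for a spanning set only if `d = 0`, is `0`. -/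
def pseudoNorm {d : ℕ} (S : Set (EuclideanSpace ℝ (Fin d))) (x : EuclideanSpace ℝ (Fin d)) :
    ℝ≥0∞ :=
  ⨆ v ∈ S, ENNReal.ofReal (inner ℝ v x)

/-- The linear map `v ↦ Σ^{1/2} v` on `ℝ^d`, with `Σ^{1/2}` the positive semidefinite square root
of the positive semidefinite matrix `Σ`. -/
def sqrtMap {d : ℕ} (Sig : Matrix (Fin d) (Fin d) ℝ) :
    EuclideanSpace ℝ (Fin d) →L[ℝ] EuclideanSpace ℝ (Fin d) :=
  Matrix.toEuclideanCLM (𝕜 := ℝ) (CFC.sqrt Sig)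

/-- The Gaussian mean width `ℓ*(T) = 𝔼 sup_{x ∈ T} ⟪G, x⟫`, `G ∼ N(0, I_d)`, of a symmetric
set `T ⊆ ℝ^d`, as an element of `[0, ∞]`. -/
def gaussianMeanWidth {d : ℕ} (T : Set (EuclideanSpace ℝ (Fin d))) : ℝ≥0∞ :=
  ∫⁻ g, pseudoNorm T g ∂(stdGaussian (EuclideanSpace ℝ (Fin d)))

/-- The weak variance term `sup_{v ∈ S} ‖Σ^{1/2} v‖₂`, as an element of `[0, ∞]`. -/
def weakDeviation {d : ℕ} (Sig : Matrix (Fin d) (Fin d) ℝ) (S : Set (EuclideanSpace ℝ (Fin d))) :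
    ℝ≥0∞ :=
  ⨆ v ∈ S, ENNReal.ofReal ‖sqrtMap Sig v‖

/-- The law `ℙ_μ^N` of a sample `(X_1, …, X_N)` of i.i.d. random vectors with law `N(μ, Σ)`. -/
def sampleLaw {d : ℕ} (N : ℕ) (mu : EuclideanSpace ℝ (Fin d)) (Sig : Matrix (Fin d) (Fin d) ℝ) :
    Measure (Fin N → EuclideanSpace ℝ (Fin d)) :=
  Measure.pi fun _ => multivariateGaussian mu Sig

end

/-! The argument is Bayesian. Put the prior `N(0, Σ/N)` on the mean. Given the sample, the posterior
is Gaussian with covariance `Σ/(2N)`, whatever the data. Averaging the accuracy hypothesis over the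
prior and then fixing good data yields one centre `a` from which a `N(0, Σ/(2N))` vector has
`‖·‖_S`-distance at most `r` with probability at least `1 - δ` (`exists_center_of_estimator`). Both
lower bounds follow from this single concentration statement.

Mean width: the difference of two independent copies removes `a`, so `‖Σ^{1/2}G‖_S ≤ 2√N r` with
probability at least `(3/4)² = 9/16`. The Fernique-type bound `lintegral_stdGaussian_le` turns this
quantile into the mean bound `12√N r`.

Weak variance: testing against one `v ∈ S` puts a standard Gaussian in an interval of half-length
`√(2N) r / ‖Σ^{1/2}v‖` with probability at least `1 - δ`, and the Gaussian tail lower bound makes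
that length of order `√(log (1/δ))`. -/

/-! ### Seminorm properties of `‖·‖_S` -/

section PseudoNorm

variable {d : ℕ} (S : Set (EuclideanSpace ℝ (Fin d)))

lemma pseudoNorm_add_le (x y : EuclideanSpace ℝ (Fin d)) :
    pseudoNorm S (x + y) ≤ pseudoNorm S x + pseudoNorm S y := by
  refine iSup₂_le fun v hv => ?_
  rw [inner_add_right]
  refine ENNReal.ofReal_add_le.trans (add_le_add ?_ ?_)
  · exact le_iSup₂ (f := fun v (_ : v ∈ S) => ENNReal.ofReal (inner ℝ v x)) v hv
  · exact le_iSup₂ (f := fun v (_ : v ∈ S) => ENNReal.ofReal (inner ℝ v y)) v hv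

lemma pseudoNorm_smul_of_nonneg {c : ℝ} (hc : 0 ≤ c) (x : EuclideanSpace ℝ (Fin d)) :
    pseudoNorm S (c • x) = ENNReal.ofReal c * pseudoNorm S x := by
  simp [pseudoNorm, ENNReal.mul_iSup, inner_smul_right, ENNReal.ofReal_mul hc]

lemma pseudoNorm_neg (hS : ∀ v ∈ S, -v ∈ S) (x : EuclideanSpace ℝ (Fin d)) :
    pseudoNorm S (-x) = pseudoNorm S x := by
  have key : ∀ x, pseudoNorm S (-x) ≤ pseudoNorm S x := fun x => by
    refine iSup₂_le fun v hv => ?_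
    have := le_iSup₂ (f := fun v (_ : v ∈ S) => ENNReal.ofReal (inner ℝ v x)) (-v) (hS v hv)
    simpa [pseudoNorm] using this
  exact le_antisymm (key x) (by simpa using key (-x))

lemma pseudoNorm_smul (hS : ∀ v ∈ S, -v ∈ S) (c : ℝ) (x : EuclideanSpace ℝ (Fin d)) :
    pseudoNorm S (c • x) = ENNReal.ofReal |c| * pseudoNorm S x := by
  rcases le_total 0 c with h | h
  · rw [abs_of_nonneg h, pseudoNorm_smul_of_nonneg S h]
  · rw [abs_of_nonpos h, ← pseudoNorm_smul_of_nonneg S (by linarith), neg_smul,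
      pseudoNorm_neg S hS]

lemma measurable_pseudoNorm : Measurable (pseudoNorm S) := by
  apply LowerSemicontinuous.measurable
  refine lowerSemicontinuous_iSup fun v => lowerSemicontinuous_iSup fun _ => ?_
  exact (ENNReal.continuous_ofReal.comp (by fun_prop)).lowerSemicontinuous

lemma inner_sqrtMap_left (Sig : Matrix (Fin d) (Fin d) ℝ) (v x : EuclideanSpace ℝ (Fin d)) :
    inner ℝ (sqrtMap Sig v) x = inner ℝ v (sqrtMap Sig x) := by
  have h : IsSelfAdjoint (sqrtMap Sig) := by
    have h0 : IsSelfAdjoint (CFC.sqrt Sig) := (CFC.sqrt_nonneg Sig).isSelfAdjoint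
    exact h0.map (Matrix.toEuclideanCLM (𝕜 := ℝ) (n := Fin d))
  conv_lhs => rw [← h.adjoint_eq]
  exact ContinuousLinearMap.adjoint_inner_left _ _ _

lemma pseudoNorm_image_sqrtMap (Sig : Matrix (Fin d) (Fin d) ℝ) (x : EuclideanSpace ℝ (Fin d)) :
    pseudoNorm (sqrtMap Sig '' S) x = pseudoNorm S (sqrtMap Sig x) := by
  simp only [pseudoNorm, iSup_image, inner_sqrtMap_left]

end PseudoNorm

/-! ### Fernique's theorem with explicit constants -/

section Fernique

variable {E : Type*} [NormedAddCommGroup E] [InnerProductSpace ℝ E] [FiniteDimensional ℝ E]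
  [MeasurableSpace E] [BorelSpace E] {φ : E → ℝ≥0∞}

lemma measurePreserving_quarter_rotation :
    MeasurePreserving (fun p : E × E => ((√2 / 2) • (p.1 + p.2), (√2 / 2) • (p.2 - p.1)))
      ((stdGaussian E).prod (stdGaussian E)) ((stdGaussian E).prod (stdGaussian E)) := by
  refine ⟨by fun_prop, ?_⟩
  have h := IsGaussian.map_rotation_eq_self_of_forall_strongDual_eq_zero (μ := stdGaussian E)
    integral_strongDual_stdGaussian (Real.pi / 4)
  convert h using 2
  ext p <;> simp [ContinuousLinearMap.rotation_apply, sub_eq_neg_add]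

/-- By rotation invariance, the product on the left is the probability that `(x + y)/√2` is small
and `(y - x)/√2` is large. These two vectors differ by `√2 x`, and up to sign add up to `√2 y`, so
both `φ x` and `φ y` must exceed `t`. -/
lemma stdGaussian_le_mul_gt_le_sq (hφ : Measurable φ) (hadd : ∀ x y, φ (x + y) ≤ φ x + φ y)
    (hsmul : ∀ (c : ℝ) x, φ (c • x) = ENNReal.ofReal |c| * φ x) {a b t : ℝ}
    (ha : 0 ≤ a) (ht : 0 ≤ t) (hab : a + √2 * t ≤ b) :
    stdGaussian E {x | φ x ≤ ENNReal.ofReal a} * stdGaussian E {x | ENNReal.ofReal b < φ x} ≤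
      stdGaussian E {x | ENNReal.ofReal t < φ x} ^ 2 := by
  rw [← Measure.prod_prod, sq, ← Measure.prod_prod,
    ← measurePreserving_quarter_rotation.measure_preimage]
  swap
  · exact ((measurableSet_le hφ measurable_const).prod
      (measurableSet_lt measurable_const hφ)).nullMeasurableSet
  apply measure_mono
  rintro ⟨x, y⟩ ⟨hu, hw⟩
  simp only [Set.mem_ofPred_eq] at hu hw
  have key : ∀ z : E, φ ((√2 / 2) • (y - x)) ≤ φ ((√2 / 2) • (x + y)) + φ (√2 • z) →
      ENNReal.ofReal t < φ z := by
    intro z hz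
    by_contra! hle
    refine hw.not_ge (hz.trans ?_)
    rw [hsmul √2 z, abs_of_nonneg (Real.sqrt_nonneg 2)]
    calc _ ≤ ENNReal.ofReal a + ENNReal.ofReal √2 * ENNReal.ofReal t := by gcongr
      _ = ENNReal.ofReal (a + √2 * t) := by
        rw [← ENNReal.ofReal_mul (Real.sqrt_nonneg 2), ENNReal.ofReal_add ha (by positivity)]
      _ ≤ ENNReal.ofReal b := ENNReal.ofReal_le_ofReal hab
  have hneg : ∀ z, φ (-z) = φ z := fun z => by simpa using hsmul (-1) z
  constructor
  · refine key x ?_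
    calc φ ((√2 / 2) • (y - x)) = φ ((√2 / 2) • (x + y) + -(√2 • x)) := by
          congr 1; module
      _ ≤ _ := by rw [← hneg (√2 • x)]; exact hadd _ _
  · refine key y ?_
    calc φ ((√2 / 2) • (y - x)) = φ (-((√2 / 2) • (x + y)) + √2 • y) := by
          congr 1; module
      _ ≤ _ := by rw [← hneg ((√2 / 2) • (x + y))]; exact hadd _ _

/-- Thresholds growing fast enough for the iteration of `stdGaussian_le_mul_gt_le_sq`. -/
noncomputable def ferniqueThreshold : ℕ → ℝ
  | 0 => 1
  | n + 1 => 5 / 4 * 2 ^ (n + 1)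

lemma ferniqueThreshold_pos (n : ℕ) : 0 < ferniqueThreshold n := by
  cases n <;> simp [ferniqueThreshold]

lemma ferniqueThreshold_succ (n : ℕ) :
    1 + √2 * ferniqueThreshold n ≤ ferniqueThreshold (n + 1) := by
  have h : √2 ≤ 1.4143 := by
    rw [Real.sqrt_le_left (by norm_num)]; norm_num
  cases n with
  | zero => simp only [ferniqueThreshold]; linarith
  | succ n =>
    simp only [ferniqueThreshold]
    have h1 : (1 : ℝ) ≤ 2 ^ n := one_le_pow₀ (by norm_num)
    rw [pow_succ (2 : ℝ) (n + 1), pow_succ]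
    nlinarith

/-- Each step squares the tail and costs a factor `16/9`, so `16/9` times the tail is squared; it
starts at `16/9 · 7/16 = 7/9`. -/
lemma stdGaussian_gt_ferniqueThreshold_le (hφ : Measurable φ)
    (hadd : ∀ x y, φ (x + y) ≤ φ x + φ y)
    (hsmul : ∀ (c : ℝ) x, φ (c • x) = ENNReal.ofReal |c| * φ x) {s : ℝ} (hs : 0 ≤ s)
    (h : 9 / 16 ≤ (stdGaussian E).real {x | φ x ≤ ENNReal.ofReal s}) (n : ℕ) :
    (stdGaussian E).real {x | ENNReal.ofReal (ferniqueThreshold n * s) < φ x} ≤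
      9 / 16 * (7 / 9) ^ 2 ^ n := by
  induction n with
  | zero =>
    have hc := probReal_compl_eq_one_sub (μ := stdGaussian E)
      (measurableSet_le hφ (measurable_const (a := ENNReal.ofReal s)))
    have e : {x | ENNReal.ofReal (ferniqueThreshold 0 * s) < φ x} =
        {x | φ x ≤ ENNReal.ofReal s}ᶜ := by
      ext x; simp [ferniqueThreshold]
    rw [e, hc]
    norm_num
    linarith
  | succ n ih =>
    have hT := ferniqueThreshold_succ n
    have h1 := stdGaussian_le_mul_gt_le_sq hφ hadd hsmul (a := s)
      (b := ferniqueThreshold (n + 1) * s) (t := ferniqueThreshold n * s) hs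
      (mul_nonneg (ferniqueThreshold_pos n).le hs) (by nlinarith)
    have h2 := ENNReal.toReal_mono (by finiteness) h1
    rw [ENNReal.toReal_mul, ENNReal.toReal_pow] at h2
    simp only [← measureReal_def] at h2
    set F := (stdGaussian E).real {x | ENNReal.ofReal (ferniqueThreshold n * s) < φ x}
    set G := (stdGaussian E).real {x | ENNReal.ofReal (ferniqueThreshold (n + 1) * s) < φ x}
    have hF : 0 ≤ F := measureReal_nonneg
    have hG : 0 ≤ G := measureReal_nonneg
    have h3 : F ^ 2 ≤ (9 / 16 * (7 / 9) ^ 2 ^ n) ^ 2 := by gcongr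
    have h4 : 9 / 16 * G ≤ (9 / 16 * (7 / 9 : ℝ) ^ 2 ^ n) ^ 2 := by nlinarith
    rw [mul_pow, ← pow_mul, ← pow_succ] at h4
    linarith

lemma lintegral_min_le_add {α : Type*} [MeasurableSpace α] {μ : Measure α} {φ : α → ℝ≥0∞}
    (hφ : Measurable φ) {a b : ℝ} (ha : 0 ≤ a)
    (hab : a ≤ b) :
    ∫⁻ x, min (φ x) (ENNReal.ofReal b) ∂μ ≤ ∫⁻ x, min (φ x) (ENNReal.ofReal a) ∂μ +
      ENNReal.ofReal (b - a) * μ {x | ENNReal.ofReal a < φ x} := by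
  have hm : MeasurableSet {x | ENNReal.ofReal a < φ x} := measurableSet_lt measurable_const hφ
  rw [← lintegral_indicator_const hm, ← lintegral_add_left (hφ.min measurable_const)]
  refine lintegral_mono fun x => ?_
  by_cases hx : ENNReal.ofReal a < φ x
  · rw [Set.indicator_of_mem (by exact hx), min_eq_right hx.le,
      ← ENNReal.ofReal_add ha (by linarith)]
    simp
  · rw [Set.indicator_of_notMem (by exact hx)]
    push Not at hx
    simp [hx]

/-- A quantitative form of Fernique's theorem for seminorms: the mean is at most six times the
`9 / 16`-quantile. -/
lemma lintegral_stdGaussian_le (hφ : Measurable φ) (hadd : ∀ x y, φ (x + y) ≤ φ x + φ y)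
    (hsmul : ∀ (c : ℝ) x, φ (c • x) = ENNReal.ofReal |c| * φ x) {s : ℝ} (hs : 0 < s)
    (h : 9 / 16 ≤ (stdGaussian E).real {x | φ x ≤ ENNReal.ofReal s}) :
    ∫⁻ x, φ x ∂(stdGaussian E) ≤ ENNReal.ofReal (6 * s) := by
  set T := ferniqueThreshold with hT
  have hTpos := ferniqueThreshold_pos
  have hTstep : ∀ n, T n ≤ T (n + 1) := fun n => by
    nlinarith [ferniqueThreshold_succ n, hTpos n, Real.one_lt_sqrt_two]
  set I : ℕ → ℝ≥0∞ := fun n => ∫⁻ x, min (φ x) (ENNReal.ofReal (T n * s)) ∂(stdGaussian E)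
  have hstep : ∀ (n : ℕ) (K : ℝ), 0 ≤ K → I n ≤ ENNReal.ofReal (K * s) →
      I (n + 1) ≤ ENNReal.ofReal ((K + (T (n + 1) - T n) * (9 / 16 * (7 / 9) ^ 2 ^ n)) * s) := by
    intro n K hK hI
    have h0 : 0 ≤ T (n + 1) - T n := sub_nonneg.2 (hTstep n)
    have h1 : stdGaussian E {x | ENNReal.ofReal (T n * s) < φ x} ≤
        ENNReal.ofReal (9 / 16 * (7 / 9) ^ 2 ^ n) := by
      rw [← ofReal_measureReal]
      exact ENNReal.ofReal_le_ofReal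
        (stdGaussian_gt_ferniqueThreshold_le hφ hadd hsmul hs.le h n)
    refine (lintegral_min_le_add hφ (mul_nonneg (hTpos n).le hs.le)
      (mul_le_mul_of_nonneg_right (hTstep n) hs.le)).trans ?_
    calc _ ≤ ENNReal.ofReal (K * s) +
          ENNReal.ofReal (T (n + 1) * s - T n * s) * ENNReal.ofReal (9 / 16 * (7 / 9) ^ 2 ^ n) := by
          gcongr
      _ = _ := by
          rw [← ENNReal.ofReal_mul (by nlinarith), ← ENNReal.ofReal_add (by positivity)
            (mul_nonneg (by nlinarith) (by positivity))]
          congr 1; ring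
  have I0 : I 0 ≤ ENNReal.ofReal (1 * s) := by
    calc I 0 ≤ ∫⁻ _, ENNReal.ofReal (T 0 * s) ∂(stdGaussian E) :=
          lintegral_mono fun x => min_le_right _ _
      _ = _ := by simp [hT, ferniqueThreshold]
  -- From `n = 3` on, `(7/9)^(2^n) ≤ 1/4`, so the increments `45/64 · 2^n (7/9)^(2^n)` at least
  -- halve at each step. Reserving twice the current one, with factor `45/32`, covers all that
  -- remain.
  have I3 : I 3 ≤ ENNReal.ofReal ((6 - 45 / 32 * (2 ^ 3 * (7 / 9) ^ 2 ^ 3)) * s) := by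
    refine (hstep 2 _ ?_ (hstep 1 _ ?_ (hstep 0 _ zero_le_one I0))).trans
      (ENNReal.ofReal_le_ofReal (mul_le_mul_of_nonneg_right ?_ hs.le)) <;>
    norm_num [hT, ferniqueThreshold]
  have hsmall : ∀ k : ℕ, (7 / 9 : ℝ) ^ 2 ^ (3 + k) ≤ 1 / 4 := fun k =>
    calc (7 / 9 : ℝ) ^ 2 ^ (3 + k) ≤ (7 / 9) ^ 2 ^ 3 :=
          pow_le_pow_of_le_one (by norm_num) (by norm_num)
            (Nat.pow_le_pow_right (by norm_num) (by omega))
      _ ≤ 1 / 4 := by norm_num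
  have hrec : ∀ k : ℕ, (2 : ℝ) ^ (3 + (k + 1)) * (7 / 9) ^ 2 ^ (3 + (k + 1)) =
      2 * (2 ^ (3 + k) * (7 / 9) ^ 2 ^ (3 + k)) * (7 / 9) ^ 2 ^ (3 + k) := fun k => by
    rw [← add_assoc, pow_succ 2 (3 + k), pow_succ 2 (3 + k), pow_mul]; ring
  have hI : ∀ k : ℕ, I (3 + k) ≤
      ENNReal.ofReal ((6 - 45 / 32 * (2 ^ (3 + k) * (7 / 9) ^ 2 ^ (3 + k))) * s) := by
    intro k
    have hbd : ∀ k : ℕ, (2 : ℝ) ^ (3 + k) * (7 / 9) ^ 2 ^ (3 + k) ≤ 2 := by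
      intro k
      induction k with
      | zero => norm_num
      | succ k ih =>
        rw [hrec]
        have := hsmall k
        have : (0 : ℝ) ≤ 2 ^ (3 + k) * (7 / 9) ^ 2 ^ (3 + k) := by positivity
        nlinarith
    induction k with
    | zero => exact I3
    | succ k ih =>
      refine (hstep (3 + k) _ (by linarith [hbd k]) ih).trans
        (ENNReal.ofReal_le_ofReal (mul_le_mul_of_nonneg_right ?_ hs.le))
      have eT : T (3 + k + 1) - T (3 + k) = 5 / 4 * 2 ^ (3 + k) := by
        rw [show 3 + k = k + 2 + 1 by ring]
        simp only [hT, ferniqueThreshold]; ring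
      rw [hrec, eT]
      have := hsmall k
      have : (0 : ℝ) ≤ 2 ^ (3 + k) * (7 / 9) ^ 2 ^ (3 + k) := by positivity
      nlinarith
  have hmono : Monotone T := monotone_nat_of_le_succ hTstep
  have hsup : ∀ x, φ x = ⨆ n, min (φ x) (ENNReal.ofReal (T n * s)) := by
    intro x
    rw [← inf_iSup_eq]
    have htop : ⨆ n, ENNReal.ofReal (T n * s) = ⊤ := by
      refine iSup_eq_top.2 fun b hb => ?_
      obtain ⟨n, hn⟩ := pow_unbounded_of_one_lt (b.toReal / s) (one_lt_two (α := ℝ))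
      refine ⟨n + 1, (ENNReal.lt_ofReal_iff_toReal_lt hb.ne).2 ?_⟩
      rw [div_lt_iff₀ hs] at hn
      refine hn.trans_le (mul_le_mul_of_nonneg_right ?_ hs.le)
      simp only [hT, ferniqueThreshold, pow_succ]
      nlinarith [pow_pos (zero_lt_two (α := ℝ)) n]
    rw [htop]; simp
  calc ∫⁻ x, φ x ∂(stdGaussian E) = ⨆ n, I n := by
        rw [lintegral_congr hsup]
        exact lintegral_iSup (fun n => hφ.min measurable_const) fun m n hmn x => min_le_min_left _
          (ENNReal.ofReal_le_ofReal (mul_le_mul_of_nonneg_right (hmono hmn) hs.le))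
    _ ≤ ENNReal.ofReal (6 * s) := by
        refine iSup_le fun n => ?_
        have hn : I n ≤ I (3 + n) := lintegral_mono fun x => min_le_min_left _
          (ENNReal.ofReal_le_ofReal (mul_le_mul_of_nonneg_right (hmono (by omega)) hs.le))
        refine hn.trans ((hI n).trans
          (ENNReal.ofReal_le_ofReal (mul_le_mul_of_nonneg_right ?_ hs.le)))
        have : (0 : ℝ) ≤ 2 ^ (3 + n) * (7 / 9) ^ 2 ^ (3 + n) := by positivity
        linarith

end Fernique

/-! ### Gaussian prior and posterior as a linear change of variables -/

section BayesianShift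

variable {E : Type*} [NormedAddCommGroup E] [InnerProductSpace ℝ E]

/-- The linear map rewriting a centre `g` and a noise `y` in terms of the posterior fluctuation `z`
(first argument), the sample mean `w` and the residuals `y i - mean y`. -/
noncomputable def posteriorMap (E : Type*) [NormedAddCommGroup E] [InnerProductSpace ℝ E] (N : ℕ) :
    E × E × (Fin N → E) →L[ℝ] E × (Fin N → E) :=
  ((√2)⁻¹ • (ContinuousLinearMap.fst ℝ E _ +
    (ContinuousLinearMap.fst ℝ E _).comp (ContinuousLinearMap.snd ℝ E _))).prod
  (ContinuousLinearMap.pi fun i =>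
    (√(2 * N))⁻¹ • ((ContinuousLinearMap.fst ℝ E _).comp (ContinuousLinearMap.snd ℝ E _) -
      ContinuousLinearMap.fst ℝ E _) +
    (ContinuousLinearMap.proj (R := ℝ) (φ := fun _ : Fin N => E) i -
      (N : ℝ)⁻¹ • ∑ j, ContinuousLinearMap.proj (R := ℝ) (φ := fun _ : Fin N => E) j).comp
      ((ContinuousLinearMap.snd ℝ E _).comp (ContinuousLinearMap.snd ℝ E _)))

lemma posteriorMap_apply {N : ℕ} (z w : E) (y : Fin N → E) :
    posteriorMap E N (z, w, y) = ((√2)⁻¹ • (z + w),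
      fun i => (√(2 * N))⁻¹ • (w - z) + (y i - (N : ℝ)⁻¹ • ∑ j, y j)) := by
  ext <;> simp [posteriorMap]

/-- The adjoint of `posteriorMap` is an isometric embedding; this is what makes the characteristic
functions agree. -/
lemma norm_sq_posterior_eq {N : ℕ} (hN : 0 < N) (s : E) (t : Fin N → E) :
    ‖(√2)⁻¹ • s - (√(2 * N))⁻¹ • ∑ j, t j‖ ^ 2 + ‖(√2)⁻¹ • s + (√(2 * N))⁻¹ • ∑ j, t j‖ ^ 2 +
      ∑ i, ‖t i - (N : ℝ)⁻¹ • ∑ j, t j‖ ^ 2 = ‖s‖ ^ 2 + ∑ i, ‖t i‖ ^ 2 := by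
  have hN' : (0 : ℝ) < N := by exact_mod_cast hN
  have h1 : (√2)⁻¹ ^ 2 = (1 / 2 : ℝ) := by rw [inv_pow, Real.sq_sqrt (by norm_num)]; norm_num
  have h2 : (√(2 * N))⁻¹ ^ 2 = (1 / (2 * N) : ℝ) := by
    rw [inv_pow, Real.sq_sqrt (by positivity)]; simp
  have h3 : ∑ i, ‖t i - (N : ℝ)⁻¹ • ∑ j, t j‖ ^ 2 =
      ∑ i, ‖t i‖ ^ 2 - (N : ℝ)⁻¹ * ‖∑ j, t j‖ ^ 2 := by
    simp_rw [norm_sub_sq_real, inner_smul_right, norm_smul, mul_pow]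
    rw [Finset.sum_add_distrib, Finset.sum_sub_distrib, ← Finset.mul_sum, ← Finset.mul_sum,
      ← sum_inner, real_inner_self_eq_norm_sq]
    simp
    field_simp
    ring
  rw [h3, norm_sub_sq_real, norm_add_sq_real, norm_smul, norm_smul, mul_pow, mul_pow,
    Real.norm_eq_abs, Real.norm_eq_abs, sq_abs, sq_abs, h1, h2]
  field_simp
  ring

variable [FiniteDimensional ℝ E] [MeasurableSpace E] [BorelSpace E]

lemma charFunDual_stdGaussian_of_inner (s : E) (L : StrongDual ℝ E) (h : ∀ x, L x = inner ℝ s x) :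
    charFunDual (stdGaussian E) L = Complex.exp (-‖s‖ ^ 2 / 2) := by
  have : L = innerSL ℝ s := by ext x; simp [h]
  rw [charFunDual_stdGaussian, this, innerSL_apply_norm]

lemma measurePreserving_posteriorMap {N : ℕ} (hN : 0 < N) :
    MeasurePreserving (posteriorMap E N)
      ((stdGaussian E).prod ((stdGaussian E).prod (Measure.pi fun _ => stdGaussian E)))
      ((stdGaussian E).prod (Measure.pi fun _ => stdGaussian E)) := by
  have hm : Measurable (posteriorMap E N) := by fun_prop
  refine ⟨hm, ?_⟩
  have := Measure.isProbabilityMeasure_map (μ := (stdGaussian E).prod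
    ((stdGaussian E).prod (Measure.pi fun _ : Fin N => stdGaussian E))) hm.aemeasurable
  refine Measure.ext_of_charFunDual (funext fun L => ?_)
  obtain ⟨s, t, hL⟩ : ∃ (s : E) (t : Fin N → E),
      ∀ a b, L (a, b) = inner ℝ s a + ∑ i, inner ℝ (t i) (b i) := by
    refine ⟨(InnerProductSpace.toDual ℝ E).symm (L.comp (.inl ℝ E _)), fun i =>
      (InnerProductSpace.toDual ℝ E).symm
        ((L.comp (.inr ℝ E _)).comp (.single ℝ (fun _ : Fin N => E) i)), fun a b => ?_⟩
    simp only [InnerProductSpace.toDual_symm_apply]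
    rw [← L.comp_inl_add_comp_inr, ← (L.comp (.inr ℝ E _)).sum_comp_single]
  have : OpensMeasurableSpace (E × E × (Fin N → E)) := inferInstance
  have hmap := charFunDual_map
    (μ := (stdGaussian E).prod ((stdGaussian E).prod (Measure.pi fun _ : Fin N => stdGaussian E)))
    (posteriorMap E N) L
  rw [hmap, charFunDual_prod, charFunDual_prod, charFunDual_prod, charFunDual_pi,
    charFunDual_pi]
  have hi : ∀ i : Fin N, ∀ x : E, ∀ j, (Pi.single i x : Fin N → E) j = if j = i then x else 0 :=
    fun i x j => by rw [Pi.single_apply]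
  rw [charFunDual_stdGaussian_of_inner ((√2)⁻¹ • s - (√(2 * N))⁻¹ • ∑ j, t j),
    charFunDual_stdGaussian_of_inner ((√2)⁻¹ • s + (√(2 * N))⁻¹ • ∑ j, t j),
    Finset.prod_congr rfl (fun i _ =>
      charFunDual_stdGaussian_of_inner (t i - (N : ℝ)⁻¹ • ∑ j, t j) _ ?_),
    charFunDual_stdGaussian_of_inner s,
    Finset.prod_congr rfl (fun i _ => charFunDual_stdGaussian_of_inner (t i) _ ?_)]
  · rw [← Complex.exp_sum, ← Complex.exp_sum, ← Complex.exp_add, ← Complex.exp_add,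
      ← Complex.exp_add]
    have := congrArg (fun x : ℝ => (-x / 2 : ℂ)) (norm_sq_posterior_eq hN s t)
    push_cast at this
    congr 1
    simp_rw [← Finset.sum_div, Finset.sum_neg_distrib]
    linear_combination this
  · intro x
    simp [hL, hi, apply_ite]
  · intro x
    simp [hL]
  · intro x
    simp [hL, hi, posteriorMap_apply, inner_sub_left, inner_sub_right, inner_smul_left,
      inner_smul_right, sum_inner, Finset.sum_sub_distrib, apply_ite, Finset.mul_sum]
  · intro x
    simp [hL, posteriorMap_apply, inner_add_left, inner_smul_left,
      inner_smul_right, sum_inner, Finset.mul_sum]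
  · intro x
    change L (posteriorMap E N (x, 0, 0)) = _
    simp [hL, posteriorMap_apply, inner_add_left, inner_smul_left,
      inner_smul_right, sum_inner, Finset.mul_sum, sub_eq_add_neg]

end BayesianShift

/-! ### From an estimator to a concentrated posterior -/

section Posterior

variable {d N : ℕ}

lemma sampleLaw_eq_map (mu : EuclideanSpace ℝ (Fin d)) (Sig : Matrix (Fin d) (Fin d) ℝ) :
    sampleLaw N mu Sig = (Measure.pi fun _ : Fin N => stdGaussian (EuclideanSpace ℝ (Fin d))).map
      fun y i => mu + sqrtMap Sig (y i) := by
  have hm : Measurable fun x : EuclideanSpace ℝ (Fin d) => mu + sqrtMap Sig x := by fun_prop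
  have := fun _ : Fin N => (Measure.isProbabilityMeasure_map
    (μ := stdGaussian (EuclideanSpace ℝ (Fin d))) hm.aemeasurable)
  rw [Measure.pi_map_pi (f := fun _ x => mu + sqrtMap Sig x) (fun _ => hm.aemeasurable)]
  rfl

/-- An estimator with uniform accuracy `r` yields a centre around which the posterior fluctuation
for the prior `N(0, Σ / N)` concentrates. -/
lemma exists_center_of_estimator (hN : 0 < N) (Sig : Matrix (Fin d) (Fin d) ℝ)
    (S : Set (EuclideanSpace ℝ (Fin d))) {δ : ℝ}
    (muHat : (Fin N → EuclideanSpace ℝ (Fin d)) → EuclideanSpace ℝ (Fin d))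
    (hmeas : Measurable muHat) {r : ℝ≥0∞}
    (hr : ∀ mu : EuclideanSpace ℝ (Fin d),
      1 - δ ≤ (sampleLaw N mu Sig).real {x | pseudoNorm S (muHat x - mu) ≤ r}) :
    ∃ a : EuclideanSpace ℝ (Fin d), 1 - δ ≤ (stdGaussian (EuclideanSpace ℝ (Fin d))).real
      {z | pseudoNorm S (a - (√(2 * N))⁻¹ • sqrtMap Sig z) ≤ r} := by
  set γ := stdGaussian (EuclideanSpace ℝ (Fin d))
  set A := sqrtMap Sig
  set P : Measure (Fin N → EuclideanSpace ℝ (Fin d)) := Measure.pi fun _ => γ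
  have hA : Measurable A := A.continuous.measurable
  have hpn := measurable_pseudoNorm S
  let f : EuclideanSpace ℝ (Fin d) × (Fin N → EuclideanSpace ℝ (Fin d)) → ℝ≥0∞ := fun p =>
    pseudoNorm S (muHat (fun i => (√N)⁻¹ • A p.1 + A (p.2 i)) - (√N)⁻¹ • A p.1)
  have hf : Measurable f := by
    refine hpn.comp ((hmeas.comp (measurable_pi_lambda _ fun i => ?_)).sub ?_) <;> fun_prop
  have hB : MeasurableSet {p | f p ≤ r} := measurableSet_le hf measurable_const
  have hprior : ENNReal.ofReal (1 - δ) ≤ (γ.prod P) {p | f p ≤ r} := by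
    rw [Measure.prod_apply hB]
    calc ENNReal.ofReal (1 - δ) = ∫⁻ _, ENNReal.ofReal (1 - δ) ∂γ := by simp
      _ ≤ _ := lintegral_mono fun g => ?_
    have h := hr ((√N)⁻¹ • A g)
    have hset : MeasurableSet {x | pseudoNorm S (muHat x - (√N)⁻¹ • A g) ≤ r} :=
      measurableSet_le (hpn.comp (hmeas.sub_const _)) measurable_const
    rw [sampleLaw_eq_map, measureReal_def, ← ENNReal.ofReal_le_iff_le_toReal (by finiteness),
      Measure.map_apply (by fun_prop) hset] at h
    exact h
  rw [← (measurePreserving_posteriorMap hN).measure_preimage hB.nullMeasurableSet,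
    Measure.prod_apply_symm ((measurePreserving_posteriorMap hN).measurable hB)] at hprior
  -- Some value of `(w, y)` does at least as well as the average.
  obtain ⟨⟨w, y⟩, hwy⟩ := exists_lintegral_le (μ := γ.prod P)
    (f := fun q => γ ((fun z => (z, q)) ⁻¹' (posteriorMap _ N ⁻¹' {p | f p ≤ r})))
    (ne_top_of_le_ne_top (by finiteness) ((lintegral_mono fun q => prob_le_one).trans_eq
      (lintegral_const (μ := γ.prod P) 1)))
  have hc : (√N)⁻¹ * (√2)⁻¹ = (√(2 * N) : ℝ)⁻¹ := by
    rw [Real.sqrt_mul (by norm_num), mul_inv, mul_comm]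
  set c := (√(2 * N) : ℝ)⁻¹ with hcd
  refine ⟨muHat (fun i => (2 * c) • A w + A (y i - (N : ℝ)⁻¹ • ∑ j, y j)) - c • A w, ?_⟩
  rw [measureReal_def, ← ENNReal.ofReal_le_iff_le_toReal (by finiteness)]
  refine (hprior.trans hwy).trans_eq (congrArg γ (Set.ext fun z => ?_))
  simp only [Set.mem_preimage, Set.mem_ofPred_eq, f, posteriorMap_apply, map_smul, map_add,
    smul_smul, hc, ← hcd]
  -- The fluctuation `z` cancels from the sample, so the estimate is constant on the fibre over `(w,
  -- y)`.
  have e1 : ∀ i, c • (A z + A w) + (c • A (w - z) + A (y i - (N : ℝ)⁻¹ • ∑ j, y j)) =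
      (2 * c) • A w + A (y i - (N : ℝ)⁻¹ • ∑ j, y j) := fun i => by
    rw [map_sub]; module
  simp_rw [e1]
  rw [smul_add, add_comm (c • A z), sub_add_eq_sub_sub]

end Posterior

/-! ### Removing the centre with an independent copy -/

section Symmetrization

variable {E : Type*} [NormedAddCommGroup E] [InnerProductSpace ℝ E] [FiniteDimensional ℝ E]
  [MeasurableSpace E] [BorelSpace E] {φ : E → ℝ≥0∞}

/-- If a standard Gaussian vector lies in `A` with probability at least `p`, and `φ ≤ s` on the
rescaled differences of points of `A`, then `φ ≤ s` with probability at least `p ^ 2`: compare two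
independent copies. -/
lemma sq_le_stdGaussian_of_forall_sub (hφ : Measurable φ) {p s : ℝ≥0∞} {A : Set E}
    (hp : p ≤ stdGaussian E A)
    (hdiff : ∀ x ∈ A, ∀ y ∈ A, φ ((√2 / 2) • (y - x)) ≤ s) :
    p ^ 2 ≤ stdGaussian E {x | φ x ≤ s} := by
  calc p ^ 2 ≤ stdGaussian E A * stdGaussian E A := by rw [sq]; gcongr
    _ = ((stdGaussian E).prod (stdGaussian E)) (A ×ˢ A) := (Measure.prod_prod _ _).symm
    _ ≤ ((stdGaussian E).prod (stdGaussian E))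
        ((fun p : E × E => ((√2 / 2) • (p.1 + p.2), (√2 / 2) • (p.2 - p.1))) ⁻¹'
          (Set.univ ×ˢ {x | φ x ≤ s})) :=
      measure_mono fun q hq => ⟨trivial, hdiff _ hq.1 _ hq.2⟩
    _ = stdGaussian E {x | φ x ≤ s} := by
      rw [measurePreserving_quarter_rotation.measure_preimage
        (MeasurableSet.univ.prod (measurableSet_le hφ measurable_const)).nullMeasurableSet,
        Measure.prod_prod]
      simp

end Symmetrization

/-! ### The mean width bound -/

section MeanWidth

variable {d N : ℕ}

lemma gaussianMeanWidth_le_of_center (hN : 0 < N) (Sig : Matrix (Fin d) (Fin d) ℝ)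
    (S : Set (EuclideanSpace ℝ (Fin d))) (hsymm : ∀ v ∈ S, -v ∈ S) {δ : ℝ} (hδ : δ ≤ 1 / 4)
    {r : ℝ≥0} {a : EuclideanSpace ℝ (Fin d)}
    (ha : 1 - δ ≤ (stdGaussian (EuclideanSpace ℝ (Fin d))).real
      {z | pseudoNorm S (a - (√(2 * N))⁻¹ • sqrtMap Sig z) ≤ (r : ℝ≥0∞)}) :
    gaussianMeanWidth (sqrtMap Sig '' S) ≤ ENNReal.ofReal (12 * √N * r) := by
  have hN' : (0 : ℝ) < √N := Real.sqrt_pos.2 (by exact_mod_cast hN)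
  set φ : EuclideanSpace ℝ (Fin d) → ℝ≥0∞ := fun x => pseudoNorm S (sqrtMap Sig x)
  have hφ : Measurable φ := (measurable_pseudoNorm S).comp (by fun_prop)
  have hadd : ∀ x y, φ (x + y) ≤ φ x + φ y := fun x y => by
    simp only [φ, map_add]; exact pseudoNorm_add_le S _ _
  have hsmul : ∀ (c : ℝ) x, φ (c • x) = ENNReal.ofReal |c| * φ x := fun c x => by
    simp only [φ, map_smul]; exact pseudoNorm_smul S hsymm _ _
  have hdiff : ∀ x ∈ {z | pseudoNorm S (a - (√(2 * N))⁻¹ • sqrtMap Sig z) ≤ (r : ℝ≥0∞)},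
      ∀ y ∈ {z | pseudoNorm S (a - (√(2 * N))⁻¹ • sqrtMap Sig z) ≤ (r : ℝ≥0∞)},
      φ ((√2 / 2) • (y - x)) ≤ ENNReal.ofReal (2 * √N * r) := by
    intro x hx y hy
    have e : sqrtMap Sig ((√2 / 2) • (y - x)) =
        √N • ((a - (√(2 * N))⁻¹ • sqrtMap Sig x) + -(a - (√(2 * N))⁻¹ • sqrtMap Sig y)) := by
      have h2 : √2 * √2 = 2 := Real.mul_self_sqrt (by norm_num)
      have hc : √2 / 2 = √N * (√(2 * N))⁻¹ := by
        rw [Real.sqrt_mul (by norm_num)]; field_simp; linarith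
      rw [map_smul, map_sub, hc]; module
    simp only [φ]
    rw [e, pseudoNorm_smul S hsymm, abs_of_pos hN', mul_comm 2 (√N : ℝ), mul_assoc (√N : ℝ) 2,
      ENNReal.ofReal_mul hN'.le, two_mul (r : ℝ), ENNReal.ofReal_add r.coe_nonneg r.coe_nonneg,
      ENNReal.ofReal_coe_nnreal]
    gcongr
    refine (pseudoNorm_add_le S _ _).trans (add_le_add hx ?_)
    rw [pseudoNorm_neg S hsymm]
    exact hy
  have h34 : ENNReal.ofReal (3 / 4) ≤ stdGaussian (EuclideanSpace ℝ (Fin d))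
      {z | pseudoNorm S (a - (√(2 * N))⁻¹ • sqrtMap Sig z) ≤ (r : ℝ≥0∞)} := by
    rw [ENNReal.ofReal_le_iff_le_toReal (by finiteness)]
    exact le_trans (by linarith) ha
  have hq := sq_le_stdGaussian_of_forall_sub hφ h34 hdiff
  rw [← ENNReal.ofReal_pow (by norm_num), ENNReal.ofReal_le_iff_le_toReal (by finiteness)] at hq
  simp only [gaussianMeanWidth, pseudoNorm_image_sqrtMap]
  -- The quantile in `lintegral_stdGaussian_le` must be positive while `r` may be `0`; a slack of `ε
  -- / 6` costs `ε` in the mean.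
  refine ENNReal.le_of_forall_pos_le_add fun ε hε _ => ?_
  have hs : 0 < 2 * √N * r + ε / 6 := by positivity
  refine (lintegral_stdGaussian_le hφ hadd hsmul hs ?_).trans_eq ?_
  · refine le_trans (le_trans (by norm_num) hq) (measureReal_mono fun x hx => ?_)
    exact le_trans hx (ENNReal.ofReal_le_ofReal
      (le_add_of_nonneg_right (by positivity)))
  · rw [show 6 * (2 * √N * r + ε / 6) = 12 * √N * (r : ℝ) + (ε : ℝ) by ring,
      ENNReal.ofReal_add (by positivity) ε.coe_nonneg, ENNReal.ofReal_coe_nnreal]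

end MeanWidth

/-! ### The weak variance bound -/

section WeakDeviation

/-- A lower bound for Gaussian tails, from `(x + t) ^ 2 ≤ 2 * x ^ 2 + 2 * t ^ 2`. -/
lemma exp_le_gaussianReal_Ioi (t : ℝ) :
    ENNReal.ofReal (Real.exp (-t ^ 2) / (2 * √2)) ≤ gaussianReal 0 1 (Set.Ioi t) := by
  have hhalf : (1 / 2 : ℝ≥0) ≠ 0 := by norm_num
  have hmap : gaussianReal 0 1 (Set.Ioi t) = gaussianReal (-t) 1 (Set.Ioi 0) := by
    have h := gaussianReal_map_add_const (μ := 0) (v := 1) (-t)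
    rw [zero_add] at h
    rw [← h, Measure.map_apply (by fun_prop) measurableSet_Ioi]
    congr 1
    ext x
    simp
  have hsymm : gaussianReal 0 (1 / 2) (Set.Ioi 0) = ENNReal.ofReal (1 / 2) := by
    have hneg : gaussianReal 0 (1 / 2) (Set.Iio 0) = gaussianReal 0 (1 / 2) (Set.Ioi 0) := by
      have h := gaussianReal_map_neg (μ := 0) (v := 1 / 2)
      rw [neg_zero] at h
      conv_rhs => rw [← h, Measure.map_apply (by fun_prop) measurableSet_Ioi]
      congr 1
      ext x
      simp
    have := nullSingletonClass_gaussianReal (μ := 0) hhalf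
    have h1 : gaussianReal 0 (1 / 2) (Set.Iio 0) + gaussianReal 0 (1 / 2) (Set.Ioi 0) = 1 := by
      rw [measure_congr (Iio_ae_eq_Iic (μ := gaussianReal 0 (1 / 2)) (a := (0 : ℝ))),
        ← Set.compl_Iic]
      rw [prob_add_prob_compl measurableSet_Iic]
    rw [hneg, ← two_mul] at h1
    rw [ENNReal.ofReal_div_of_pos (by norm_num), ENNReal.ofReal_one, ENNReal.ofReal_ofNat,
      ENNReal.eq_div_iff (by norm_num) (by norm_num), h1]
  -- The variance `1/2` comparison density absorbs the doubled square `2x²`, and half of its mass is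
  -- on the positive axis.
  have hpdf : ∀ x, ENNReal.ofReal (Real.exp (-t ^ 2) / √2) * gaussianPDF 0 (1 / 2) x ≤
      gaussianPDF (-t) 1 x := by
    intro x
    rw [gaussianPDF, gaussianPDF, ← ENNReal.ofReal_mul (by positivity)]
    refine ENNReal.ofReal_le_ofReal ?_
    rw [gaussianPDFReal, gaussianPDFReal]
    have hsq : √(2 * Real.pi * (1 : ℝ≥0)) = √2 * √(2 * Real.pi * (1 / 2 : ℝ≥0)) := by
      rw [← Real.sqrt_mul (by norm_num)]; congr 1; push_cast; ring
    rw [hsq]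
    have hexp : Real.exp (-t ^ 2) * Real.exp (-(x - 0) ^ 2 / (2 * (1 / 2 : ℝ≥0))) ≤
        Real.exp (-(x - -t) ^ 2 / (2 * (1 : ℝ≥0))) := by
      rw [← Real.exp_add]
      refine Real.exp_le_exp.2 ?_
      push_cast
      nlinarith [sq_nonneg (x - t)]
    calc _ = (√2 * √(2 * Real.pi * (1 / 2 : ℝ≥0)))⁻¹ *
          (Real.exp (-t ^ 2) * Real.exp (-(x - 0) ^ 2 / (2 * (1 / 2 : ℝ≥0)))) := by
          rw [mul_inv]; ring
      _ ≤ _ := by gcongr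
  rw [hmap]
  calc ENNReal.ofReal (Real.exp (-t ^ 2) / (2 * √2))
      = ENNReal.ofReal (Real.exp (-t ^ 2) / √2) * gaussianReal 0 (1 / 2) (Set.Ioi 0) := by
        rw [hsymm, ← ENNReal.ofReal_mul (by positivity)]; congr 1; field_simp
    _ ≤ gaussianReal (-t) 1 (Set.Ioi 0) := by
        rw [gaussianReal_apply _ hhalf, gaussianReal_apply _ one_ne_zero,
          ← lintegral_const_mul _ (measurable_gaussianPDF _ _)]
        exact lintegral_mono hpdf

/-- A standard Gaussian variable in an interval of half-length `t` with probability at least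
`1 - δ` forces `t` to be of order `√(log (1 / δ))`. -/
lemma log_le_of_gaussianReal_interval {δ t b : ℝ} (hδ₀ : 0 < δ) (hδ : δ ≤ 1 / 4)
    (h : 1 - δ ≤ (gaussianReal 0 1).real {x | |b - x| ≤ t}) :
    Real.log (1 / δ) ≤ 4 * t ^ 2 := by
  have hm : MeasurableSet {x : ℝ | |b - x| ≤ t} := measurableSet_le (by fun_prop) (by fun_prop)
  have hc : (gaussianReal 0 1).real {x | |b - x| ≤ t}ᶜ ≤ δ := by
    rw [probReal_compl_eq_one_sub hm]; linarith
  have htail : (gaussianReal 0 1) (Set.Ioi t) ≤ gaussianReal 0 1 {x | |b - x| ≤ t}ᶜ := by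
    -- The sign of the centre decides which tail, `(t, ∞)` or its reflection, misses the interval.
    rcases le_total b 0 with hb | hb
    · refine measure_mono fun x hx => ?_
      simp only [Set.mem_Ioi, Set.mem_compl_iff, Set.mem_ofPred_eq, not_le] at hx ⊢
      rw [lt_abs]; right; linarith
    · have hneg := gaussianReal_map_neg (μ := 0) (v := 1)
      rw [neg_zero] at hneg
      rw [← hneg, Measure.map_apply (by fun_prop) measurableSet_Ioi, hneg]
      refine measure_mono fun x hx => ?_
      simp only [Set.mem_Ioi, Set.mem_compl_iff, Set.mem_ofPred_eq, not_le, Set.mem_preimage] at hx ⊢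
      rw [lt_abs]; left; linarith
  have h1 : Real.exp (-t ^ 2) / (2 * √2) ≤ δ := by
    have := (exp_le_gaussianReal_Ioi t).trans htail
    rw [ENNReal.ofReal_le_iff_le_toReal (by finiteness)] at this
    exact this.trans hc
  have h2 : √2 * √2 = 2 := Real.mul_self_sqrt (by norm_num)
  have h3 : Real.exp (-t ^ 2) ≤ δ * (2 * √2) := (div_le_iff₀ (by positivity)).1 h1
  -- The fourth power absorbs the prefactor: `(2√2 δ)^4 = 64 δ^4 ≤ δ`, exactly because `δ ≤ 1/4`.
  have h4 : Real.exp (-t ^ 2) ^ 4 ≤ δ := by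
    have h5 : Real.exp (-t ^ 2) ^ 4 ≤ (δ * (2 * √2)) ^ 4 := by gcongr
    have h6 : (δ * (2 * √2)) ^ 4 = 64 * δ ^ 4 := by
      rw [show (δ * (2 * √2)) ^ 4 = 16 * δ ^ 4 * (√2 * √2) ^ 2 by ring, h2]; ring
    have h7 : δ ^ 3 ≤ (1 / 4) ^ 3 := by gcongr
    nlinarith
  rw [← Real.exp_nat_mul] at h4
  have := Real.log_le_log (Real.exp_pos _) h4
  rw [Real.log_exp] at this
  rw [one_div, Real.log_inv]
  push_cast at this
  linarith

variable {d N : ℕ}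

lemma stdGaussian_map_inner (u : EuclideanSpace ℝ (Fin d)) (hu : ‖u‖ = 1) :
    (stdGaussian (EuclideanSpace ℝ (Fin d))).map (fun x => inner ℝ u x) = gaussianReal 0 1 := by
  have h := IsGaussian.map_eq_gaussianReal (μ := stdGaussian (EuclideanSpace ℝ (Fin d)))
    (innerSL ℝ u)
  rw [integral_strongDual_stdGaussian, variance_dual_stdGaussian, innerSL_apply_norm, hu] at h
  simpa using h

lemma norm_sqrtMap_le_of_center (hN : 0 < N) (Sig : Matrix (Fin d) (Fin d) ℝ)
    (S : Set (EuclideanSpace ℝ (Fin d))) (hsymm : ∀ v ∈ S, -v ∈ S) {δ : ℝ} (hδ₀ : 0 < δ)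
    (hδ : δ ≤ 1 / 4) {r : ℝ≥0} {a : EuclideanSpace ℝ (Fin d)}
    (ha : 1 - δ ≤ (stdGaussian (EuclideanSpace ℝ (Fin d))).real
      {z | pseudoNorm S (a - (√(2 * N))⁻¹ • sqrtMap Sig z) ≤ (r : ℝ≥0∞)})
    {v : EuclideanSpace ℝ (Fin d)} (hv : v ∈ S) :
    1 / 12 * √(Real.log (1 / δ) / N) * ‖sqrtMap Sig v‖ ≤ r := by
  have hN' : (0 : ℝ) < N := by exact_mod_cast hN
  set σ := ‖sqrtMap Sig v‖ with hσ
  rcases (norm_nonneg (sqrtMap Sig v)).eq_or_lt with h0 | hpos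
  · rw [hσ, ← h0]; simp
  rw [← hσ] at hpos
  set u := σ⁻¹ • sqrtMap Sig v
  have hu : ‖u‖ = 1 := by
    rw [norm_smul, norm_inv, Real.norm_eq_abs, abs_of_pos hpos, inv_mul_cancel₀ hpos.ne']
  set b := σ⁻¹ * √(2 * N) * inner ℝ v a
  set t := σ⁻¹ * √(2 * N) * r
  have hlog : Real.log (1 / δ) ≤ 4 * t ^ 2 := by
    refine log_le_of_gaussianReal_interval (b := b) hδ₀ hδ (ha.trans ?_)
    rw [← stdGaussian_map_inner u hu, map_measureReal_apply (by fun_prop)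
      (measurableSet_le (by fun_prop) (by fun_prop))]
    refine measureReal_mono fun z hz => ?_
    have habs : |inner ℝ v (a - (√(2 * N))⁻¹ • sqrtMap Sig z)| ≤ r := by
      have hle : ∀ w ∈ S, inner ℝ w (a - (√(2 * N))⁻¹ • sqrtMap Sig z) ≤ (r : ℝ) := by
        intro w hw
        have h1 := (le_iSup₂ (f := fun v (_ : v ∈ S) =>
          ENNReal.ofReal (inner ℝ v (a - (√(2 * N))⁻¹ • sqrtMap Sig z))) w hw).trans hz
        rw [← ENNReal.ofReal_coe_nnreal] at h1
        exact (ENNReal.ofReal_le_ofReal_iff r.coe_nonneg).1 h1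
      refine abs_le'.2 ⟨hle v hv, ?_⟩
      rw [← inner_neg_left]
      exact hle _ (hsymm v hv)
    have e : b - inner ℝ u z = σ⁻¹ * √(2 * N) *
        inner ℝ v (a - (√(2 * N))⁻¹ • sqrtMap Sig z) := by
      rw [inner_sub_right, inner_smul_right, inner_smul_left, inner_sqrtMap_left]
      simp only [b, conj_trivial]
      field_simp
    simp only [Set.mem_preimage, Set.mem_ofPred_eq]
    rw [e, abs_mul, abs_of_pos (by positivity)]
    exact mul_le_mul_of_nonneg_left habs (by positivity)
  have ht : t ^ 2 = 2 * N * r ^ 2 / σ ^ 2 := by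
    simp only [t]
    rw [mul_pow, mul_pow, Real.sq_sqrt (by positivity)]; field_simp
  rw [ht] at hlog
  refine abs_le_of_sq_le_sq' ?_ r.coe_nonneg |>.2
  have hlog0 : 0 ≤ Real.log (1 / δ) := Real.log_nonneg (by rw [le_div_iff₀ hδ₀]; linarith)
  rw [mul_pow, mul_pow, Real.sq_sqrt (by positivity)]
  -- Only `8 ≤ 12²` is needed afterwards.
  have h1 : Real.log (1 / δ) / N * σ ^ 2 ≤ 8 * r ^ 2 := by
    rw [div_mul_eq_mul_div, div_le_iff₀ hN']
    calc _ ≤ 4 * (2 * N * r ^ 2 / σ ^ 2) * σ ^ 2 := by gcongr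
      _ = _ := by field_simp; ring
  rw [mul_assoc]
  linarith [sq_nonneg (r : ℝ)]

end WeakDeviation

theorem theorem3 {d N : ℕ} (hN : 0 < N)
    (Sig : Matrix (Fin d) (Fin d) ℝ) (hSig : Sig.PosSemidef)
    (S : Set (EuclideanSpace ℝ (Fin d))) (hsymm : ∀ v ∈ S, -v ∈ S)
    (hspan : Submodule.span ℝ S = ⊤)
    (δ : ℝ) (hδ₀ : 0 < δ) (hδ : δ ≤ 1 / 4)
    (muHat : (Fin N → EuclideanSpace ℝ (Fin d)) → EuclideanSpace ℝ (Fin d))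
    (hmeas : Measurable muHat) (r : ℝ≥0)
    (hr : ∀ mu : EuclideanSpace ℝ (Fin d),
      1 - δ ≤ (sampleLaw N mu Sig).real {x | pseudoNorm S (muHat x - mu) ≤ (r : ℝ≥0∞)}) :
    max
        (ENNReal.ofReal (1 / 24 * √(Real.log 2 / Real.log (5 / 4)) / √(N : ℝ)) *
          gaussianMeanWidth (sqrtMap Sig '' S))
        (ENNReal.ofReal (1 / 12 * √(Real.log (1 / δ) / (N : ℝ))) * weakDeviation Sig S)
      ≤ (r : ℝ≥0∞) := by
  obtain ⟨a, ha⟩ := exists_center_of_estimator hN Sig S muHat hmeas hr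
  have hN' : (0 : ℝ) < √N := Real.sqrt_pos.2 (by exact_mod_cast hN)
  refine max_le ?_ ?_
  -- With this bound the prefactor is at most `1/(12√N)`, which matches the `12√N r` from Fernique.
  · have hsq : √(Real.log 2 / Real.log (5 / 4)) ≤ 2 := by
      rw [Real.sqrt_le_left (by norm_num), div_le_iff₀ (Real.log_pos (by norm_num))]
      have h := Real.log_le_log (by norm_num) (show (2 : ℝ) ≤ (5 / 4) ^ 4 by norm_num)
      rw [Real.log_pow] at h
      norm_num at h ⊢
      exact h
    calc _ ≤ ENNReal.ofReal (1 / 24 * 2 / √N) * ENNReal.ofReal (12 * √N * r) := by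
          gcongr
          exact gaussianMeanWidth_le_of_center hN Sig S hsymm hδ ha
      _ = (r : ℝ≥0∞) := by
          rw [← ENNReal.ofReal_mul (by positivity), ← ENNReal.ofReal_coe_nnreal]
          congr 1
          field_simp
          norm_num
  · simp only [weakDeviation, ENNReal.mul_iSup]
    refine iSup₂_le fun v hv => ?_
    rw [← ENNReal.ofReal_mul (by positivity), ← ENNReal.ofReal_coe_nnreal]
    exact ENNReal.ofReal_le_ofReal (norm_sqrtMap_le_of_center hN Sig S hsymm hδ₀ hδ ha hv)
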